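/- **Setting.** The Lorenz template is a compact branched surface $\mathcal T\subset\mathbb R^3$ made of a left ear and a right ear glued along the branch line $\{(s,0,0): -1\le s\le 1\}$: the left (right) ear leaves the part $s\le 0$ ($s\ge 0$) of the branch line downwards, runs without twist once around the left (right) hole, is stretched, and returns from above to the whole branch line, the returning left ear lying in front of the returning right ear. A link embedded in $\mathcal T$ is a finite family of pairwise disjoint simple closed curves in $\mathcal T$, each a concatenation of turns; a turn runs once through an ear from the branch line to the branch line, in the direction of the ear (meeting each cross-section of the ear once), and is an $x$-turn or a $y$-turn according to whether it passes through the left or the right ear. The turns of each component, read cyclically, give its code word. A modular link $L$ is such a link in which every component has a code word that contains both letters and is primitive, and different components have different code words up to cyclic permutation. Write its labelled code words as $$w_r=x_{m+1}^{k_{m+1}}y_{m+1}^{l_{m+1}}\cdots x_{m+n_r}^{k_{m+n_r}}y_{m+n_r}^{l_{m+n_r}},\qquad m=n_1+\dots+n_{r-1},\quad r=1,\dots,c,$$ with all $k_i,l_i\ge 1$; put $\overline n=n_1+\dots+n_c$, $k_\mu=\max_i k_i$, $l_\lambda=\max_i l_i$. The turn of the $j$-th letter of the subword $x_i^{k_i}$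 (of $y_i^{l_i}$) is the $(x_i,j)$-turn (the $(y_i,j)$-turn), and the union of all of them is the $x_i^{k_i}$-arc (the $y_i^{l_i}$-arc). Consider the branch line as the part $[-R,R]$ of a real line (by means of $s\mapsto Rs$), where $R\ge \max(k_\mu,l_\lambda)+0.4$, and call $(i-0.4,\,i+0.4)$ its $i$-th interval. The order within the full $x$-bunch is an ordering $(x_{\sigma(1)},\dots,x_{\sigma(\overline n)})$ of all $x$-bases such that the turns $(x_{\sigma(1)},k_{\sigma(1)}),\dots,(x_{\sigma(\overline n)},k_{\sigma(\overline n)})$ are the $\overline n$ rightmost $x$-turns, listed from left to right by start points. The order within the full $y$-bunch is an ordering $(y_{\tau(1)},\dots,y_{\tau(\overline n)})$ of all $y$-bases such that the turns $(y_{\tau(j)},l_{\tau(j)})$ are the $\overline n$ leftmost $y$-turns, listed from left to right. For $1\le u\le k_\mu$, the link has a $-u$-th $x$-bunch if there is a subsequence $(x_{u1},\dots,x_{ub})$ of $(x_{\sigma(1)},\dots,x_{\sigma(\overline n)})$ such that the $x$-turns starting in the $-u$-th interval are exactly the $(x_{ui},k_{ui}-u+1)$-turns, $1\le i\le b$; these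 turns form the bunch. The $+v$-th $y$-bunch, $1\le v\le l_\lambda$, is defined in the same way with the $y$-turns starting in the $+v$-th interval, subsequences of $(y_{\tau(1)},\dots,y_{\tau(\overline n)})$ and the $(y_{vi},l_{vi}-v+1)$-turns. **Theorem.** Let $L$ be a modular link embedded in the Lorenz template $\mathcal T$, with the labelled code words above, and let $U\supseteq\mathcal T$ be any open subset of $\mathbb R^3$ (for instance, the complement of a knot disjoint from $\mathcal T$). Then there is an ambient isotopy of $\mathbb R^3$, fixing all points outside $U$, which carries $L$ to a link $L'$ embedded in $\mathcal T$ with the same labelled code words (each turn of $L$ being carried to the turn of $L'$ with the same label), such that $L'$ has orders within the full $x$-bunch and the full $y$-bunch, has a $-u$-th $x$-bunch for every $1\le u\le k_\mu$ and a $+v$-th $y$-bunch for every $1\le v\le l_\lambda$, is the union of the turns in these bunches, the turns of each bunch are ordered from left to right as they are listed in the bunch, and 1. for every $i\in\{1,\dots,\overline n\}$, the $x_i^{k_i}$-arc of $L'$ starts from a point in the $-k_i$-th interval; 2. for every $j\in\{1,\dots,\overline n\}$, the $y_j^{l_j}$-arc of $L'$ starts from a point in the $+l_j$-th interval. -/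

import Mathlib

open Set

/-- The two letters: `x` stands for a passage through the left ear of the Lorenz template,
`y` for a passage through the right ear. -/
inductive Letter where
  | x
  | y
  deriving DecidableEq

instance : Fintype Letter := ⟨{Letter.x, Letter.y}, by intro a; cases a <;> decide⟩

/-- `-1` for `x` (negative side of the branch line), `+1` for `y` (positive side). -/
def Letter.sgn : Letter → ℤ
  | .x => -1
  | .y => 1

/-- A finite system of labelled code words `x₁^{k₁} y₁^{l₁} ⋯ xₙ^{kₙ} yₙ^{lₙ}`, one for each of the
`c` components. The word of component `r` has period `period r ≥ 1`; the pair `⟨r, i⟩` is the label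
of the base `x_i` and of the base `y_i` in that word; `exponent .x` is the family of the
`x`-exponents and `exponent .y` that of the `y`-exponents, all of them positive. -/
structure LabelledWords where
  c : ℕ
  period : Fin c → ℕ
  period_pos : ∀ r, 0 < period r
  exponent : Letter → (Σ r : Fin c, Fin (period r)) → ℕ
  exponent_pos : ∀ a b, 0 < exponent a b

namespace LabelledWords

variable (W : LabelledWords)

/-- The labels of bases; there are `n̄ = ∑ r, period r` of them. -/
abbrev Base : Type := Σ r : Fin W.c, Fin (W.period r)

/-- The unlabelled code word of the component `r`. -/
def word (r : Fin W.c) : List Letter :=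
  (List.finRange (W.period r)).flatMap fun i =>
    List.replicate (W.exponent .x ⟨r, i⟩) Letter.x ++ List.replicate (W.exponent .y ⟨r, i⟩) Letter.y

/-- The code words are those of a modular link: each is primitive (not a proper power), and
different components have words in different cyclic permutation classes. -/
def IsModular : Prop :=
  (∀ r, ∀ (v : List Letter) (m : ℕ), W.word r = (List.replicate m v).flatten → m = 1) ∧
    ∀ r r', r ≠ r' → ¬ (W.word r).IsRotated (W.word r')

/-- The letters of the labelled code words: `⟨(a, b), j⟩` is the `(a_b, j + 1)`-letter
(`j` counts from `0`). Each letter has its turn. -/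
abbrev Turn : Type := Σ a : Letter × W.Base, Fin (W.exponent a.1 a.2)

/-- The cyclically next letter of the word. -/
def next (τ : W.Turn) : W.Turn :=
  if h : τ.2.val + 1 < W.exponent τ.1.1 τ.1.2 then ⟨τ.1, ⟨τ.2.val + 1, h⟩⟩
  else match τ.1.1 with
    | .x => ⟨(.y, τ.1.2), ⟨0, W.exponent_pos _ _⟩⟩
    | .y => ⟨(.x, ⟨τ.1.2.1, finRotate _ τ.1.2.2⟩), ⟨0, W.exponent_pos _ _⟩⟩

/-- The maximal `x`-exponent, respectively the maximal `y`-exponent. -/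
def maxExponent (a : Letter) : ℕ := Finset.univ.sup (W.exponent a)

end LabelledWords

/-- The ambient space `ℝ³`. In a point `(p, q, d)`, `p` points to the right, `q` upwards and `d`
towards the viewer. -/
abbrev Space : Type := ℝ × ℝ × ℝ

/-- The cross-section at time `t ∈ [0, 1]` of an ear. The left ear starts from the left half
`[-1, 0]` of the branch line; in the second half of its way it is stretched, and it returns to the
whole branch line `[-1, 1]`. The right ear is its mirror image. -/
def strip : Letter → ℝ → Set ℝ
  | .x, t => Icc (-1) (max 0 (2 * t - 1))
  | .y, t => Icc (-max 0 (2 * t - 1)) 1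

/-- The embedding of the two ears in space, in the coordinates `s ∈ strip a t` (across the ear) and
`t ∈ [0, 1]` (along the ear). The branch line is `{(s, 0, 0) | -1 ≤ s ≤ 1}`, where `t = 0` and
`t = 1`. The left ear leaves the branch line downwards, runs around the left hole and comes back
from above, in front of (`d > 0`) the right ear, which runs around the right hole and comes back
from above, behind (`d < 0`) the left ear. So `x`-strands cross over `y`-strands. In the
`(p, q)`-plane the line `s = const` of an ear is an ellipse, with centre `(s - 2, 0)` for the
left and `(s + 2, 0)` for the right ear; it lies in the plane `p = s - 2 d`, so that neither
ear is twisted. -/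
noncomputable def ear : Letter → ℝ → ℝ → Space
  | .x, s, t => (s - 2 * (1 - Real.cos (2 * Real.pi * t)), -Real.sin (2 * Real.pi * t),
      1 - Real.cos (2 * Real.pi * t))
  | .y, s, t => (s + 2 * (1 - Real.cos (2 * Real.pi * t)), -Real.sin (2 * Real.pi * t),
      -(1 - Real.cos (2 * Real.pi * t)))

/-- The Lorenz template, a compact branched surface in `ℝ³`. -/
def lorenzTemplate : Set Space :=
  {P | ∃ a : Letter, ∃ t ∈ Icc (0 : ℝ) 1, ∃ s ∈ strip a t, P = ear a s t}

/-- A link embedded in the Lorenz template with the labelled code words `W`. The turn of a letter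
runs once through the corresponding ear, from the branch line to the branch line, in the direction
of the ear: at time `t` it is at the point `s = pos τ t` of the cross-section. It ends where the
turn of the cyclically next letter starts. The turns (without their end points) are arcs which are
simple and pairwise disjoint; so the components are pairwise disjoint simple closed curves. -/
structure TemplateLink (W : LabelledWords) where
  pos : W.Turn → ℝ → ℝ
  continuousOn_pos : ∀ τ, ContinuousOn (pos τ) (Icc 0 1)
  pos_mem : ∀ τ, ∀ t ∈ Icc (0 : ℝ) 1, pos τ t ∈ strip τ.1.1 t
  pos_next : ∀ τ, pos τ 1 = pos (W.next τ) 0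
  injective : ∀ τ τ', ∀ t ∈ Ico (0 : ℝ) 1, ∀ t' ∈ Ico (0 : ℝ) 1,
    ear τ.1.1 (pos τ t) t = ear τ'.1.1 (pos τ' t') t' → τ = τ' ∧ t = t'

namespace TemplateLink

variable {W : LabelledWords} (L : TemplateLink W)

/-- The turn of a letter, a half-open arc. -/
def turn (τ : W.Turn) : Set Space := (fun t => ear τ.1.1 (L.pos τ t) t) '' Ico 0 1

/-- The link as a subset of space. -/
def carrier : Set Space := ⋃ τ, L.turn τ

/-- The coordinate `s` of the start point `(s, 0, 0)` of a turn on the branch line. -/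
def start (τ : W.Turn) : ℝ := L.pos τ 0

/-- `F` is the order within the full `x`-bunch (`a = .x`), respectively the full `y`-bunch
(`a = .y`): each base occurs in `F` exactly once; the turns `(x_b, k_b)`, `b ∈ F`, are listed from
left to right, and they are the rightmost `x`-turns; respectively the turns `(y_b, l_b)` are listed
from left to right, and they are the leftmost `y`-turns. -/
structure IsFullBunch (a : Letter) (F : List W.Base) : Prop where
  nodup : F.Nodup
  mem : ∀ b, b ∈ F
  leftToRight : F.Pairwise fun b b' =>
    ∀ (j : Fin (W.exponent a b)) (j' : Fin (W.exponent a b')),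
      j.val + 1 = W.exponent a b → j'.val + 1 = W.exponent a b' →
        L.start ⟨(a, b), j⟩ < L.start ⟨(a, b'), j'⟩
  extreme : ∀ b b' (j : Fin (W.exponent a b)) (j' : Fin (W.exponent a b')),
    j.val + 1 = W.exponent a b → j'.val + 1 < W.exponent a b' →
      a.sgn * L.start ⟨(a, b), j⟩ < a.sgn * L.start ⟨(a, b'), j'⟩

/-- The `i`-th interval `(i - 0.4, i + 0.4)` of the branch line, where the branch line is considered
as the part `[-R, R]` of a real line by means of the coordinate `R s`. -/
def interval (R : ℝ) (i : ℤ) : Set ℝ := {s | R * s ∈ Ioo ((i : ℝ) - 2 / 5) ((i : ℝ) + 2 / 5)}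

/-- Let `F` be the order within the full `x`-bunch. `B` is the order within the `-u`-th `x`-bunch:
it is a subsequence of `F`, the `x`-turns which start from the `-u`-th interval are exactly the
`(x_b, k_b - u + 1)`-turns with `b ∈ B`, and these turns are listed from left to right.
For `a = .y` it is the same for the `+u`-th `y`-bunch. (The index `j` counts from `0`,
so the `(a_b, e - u + 1)`-turn has `j = e - u`, where `e` is the exponent of `a_b`.) -/
structure IsBunch (R : ℝ) (a : Letter) (F : List W.Base) (u : ℕ) (B : List W.Base) : Prop where
  sublist : B.Sublist F
  start_mem_iff : ∀ (b : W.Base) (j : Fin (W.exponent a b)),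
    L.start ⟨(a, b), j⟩ ∈ interval R (a.sgn * u) ↔ b ∈ B ∧ j.val + u = W.exponent a b
  leftToRight : B.Pairwise fun b b' =>
    ∀ (j : Fin (W.exponent a b)) (j' : Fin (W.exponent a b')),
      j.val + u = W.exponent a b → j'.val + u = W.exponent a b' →
        L.start ⟨(a, b), j⟩ < L.start ⟨(a, b'), j'⟩

/-- The bunch of turns, i.e. the union of the turns which are listed in the bunch with index `u`
whose order is `B`. -/
def bunchOfTurns (a : Letter) (u : ℕ) (B : List W.Base) : Set Space :=
  ⋃ b ∈ B, ⋃ (j : Fin (W.exponent a b)) (_ : j.val + u = W.exponent a b), L.turn ⟨(a, b), j⟩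

/-- The link is the union of its `x`-bunches with the indices `-1, …, -k_μ` and its `y`-bunches
with the indices `+1, …, +l_λ`, where `k_μ`, `l_λ` are the maximal exponents; and the turns in each
bunch are ordered from left to right. -/
def IsUnionOfBunches (R : ℝ) : Prop :=
  ∃ (F : Letter → List W.Base) (B : Letter → ℕ → List W.Base),
    (∀ a, L.IsFullBunch a (F a)) ∧
    (∀ a, ∀ u ∈ Icc 1 (W.maxExponent a), L.IsBunch R a (F a) u (B a u)) ∧
    L.carrier = ⋃ a, ⋃ u ∈ Icc 1 (W.maxExponent a), L.bunchOfTurns a u (B a u)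

/-- `L` is carried to `L'` by an ambient isotopy of `ℝ³` which fixes all points outside `U`; it
carries each turn of `L` to the turn of `L'` with the same label (in particular, it
carries components to components with the same code word and respects orientations). -/
def AmbientIsotopic (U : Set Space) (L L' : TemplateLink W) : Prop :=
  ∃ H : unitInterval → (Space ≃ₜ Space),
    Continuous (fun z : unitInterval × Space => H z.1 z.2) ∧
    (∀ P, H 0 P = P) ∧
    (∀ u, ∀ P ∉ U, H u P = P) ∧
    ∀ τ, H 1 '' L.turn τ = L'.turn τ

end TemplateLink

/-!
The coordinate `s = p + 2 d` is the coordinate across both ears. In the coordinates `(s, q, d)` the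
template lies over two circles of the `(q, d)`-plane which touch at the origin, the branch line
lies over the origin, and a strand is the graph of a function `s = pos τ t` over one of the circles.
So an increasing homeomorphism `g` of the `s`-line, damped by a cut-off function of `(q, d)` around
the origin, gives an isotopy of space: a point moves from `s` towards `g s`, with `(q, d)` fixed,
and convex combinations of `g` and the identity are again increasing homeomorphisms. It is
supported near the branch line, and it moves the start points of the turns by `g`. The
cross-sections of the ears are convex, so the strands stay in the template if `g` moves all start
points into the interior of the half of the branch line to which they belong and the support is
small. Hence start points can be moved to any new positions in the same order
(`TemplateLink.exists_ambientIsotopic_start_eq`).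

It remains to see that the positions which the theorem asks for are compatible with the order of
the start points. Strands in the same ear do not cross (`TemplateLink.start_next_lt`), and `x`-turns
start to the left of `y`-turns. So an `x`-turn starts further to the left the more letters `x` are
still to come in its power, and a `y`-turn further to the right the more letters `y` are still to
come (`TemplateLink.remaining_le_of_start_lt_x`, `TemplateLink.remaining_le_of_start_lt_y`); turns
with the same number of letters to come are in the same order as the last turns of their powers
(`TemplateLink.start_lt_of_last_lt`).
-/

/-! ### Cyclic succession of letters -/

namespace LabelledWords

variable {W : LabelledWords}

/-- The number of letters from the letter of `τ` (included) to the end of the power `x_b^k` or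
`y_b^l` to which it belongs. So the `(x_b, k - u + 1)`-turn has `u` remaining letters. -/
def remaining (τ : W.Turn) : ℕ := W.exponent τ.1.1 τ.1.2 - τ.2.val

theorem remaining_mk (a : Letter) (b : W.Base) (j : Fin (W.exponent a b)) :
    remaining (⟨(a, b), j⟩ : W.Turn) = W.exponent a b - j.val := rfl

theorem remaining_pos (τ : W.Turn) : 0 < remaining τ := Nat.sub_pos_of_lt τ.2.isLt

theorem remaining_le (τ : W.Turn) : remaining τ ≤ W.exponent τ.1.1 τ.1.2 := Nat.sub_le _ _

theorem next_of_one_lt_remaining {τ : W.Turn} (h : 1 < remaining τ) :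
    (W.next τ).1.1 = τ.1.1 ∧ remaining (W.next τ) = remaining τ - 1 := by
  have h' : τ.2.val + 1 < W.exponent τ.1.1 τ.1.2 := by
    unfold remaining at h
    omega
  unfold next
  rw [dif_pos h']
  refine ⟨rfl, ?_⟩
  simp only [remaining]
  omega

theorem next_of_remaining_eq_one {τ : W.Turn} (h : remaining τ = 1) :
    (W.next τ).1.1 ≠ τ.1.1 := by
  have h' : ¬ τ.2.val + 1 < W.exponent τ.1.1 τ.1.2 := by
    unfold remaining at h
    omega
  unfold next
  rw [dif_neg h']
  obtain ⟨⟨a, b⟩, j⟩ := τ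
  cases a <;> simp

theorem next_injective_of_letter_eq {τ τ' : W.Turn} (ha : τ.1.1 = τ'.1.1)
    (h : W.next τ = W.next τ') : τ = τ' := by
  obtain ⟨⟨a, b⟩, j⟩ := τ
  obtain ⟨⟨a', b'⟩, j'⟩ := τ'
  obtain rfl : a = a' := ha
  have key : b = b' ∧ j.val = j'.val := by
    unfold next at h
    have hj := j.isLt
    have hj' := j'.isLt
    dsimp only at h hj hj'
    split_ifs at h with h₁ h₂ h₂
    · simp only [Sigma.mk.injEq, Prod.mk.injEq, true_and] at h
      obtain ⟨rfl, h⟩ := h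
      simpa using h
    · cases a <;> simp at h
    · cases a <;> simp at h
    · have hb : b = b' := by
        cases a
        · simp only [Sigma.mk.injEq, Prod.mk.injEq, true_and] at h
          exact h.1
        · simp only [Sigma.mk.injEq, Prod.mk.injEq, true_and] at h
          obtain ⟨r, i⟩ := b
          obtain ⟨r', i'⟩ := b'
          obtain ⟨⟨rfl, h⟩, -⟩ := h
          simpa using h
      subst hb
      exact ⟨rfl, by omega⟩
  obtain ⟨rfl, hj⟩ := key
  obtain rfl := Fin.ext hj
  rfl

end LabelledWords

/-! ### The order of the start points -/

theorem ear_zero (a : Letter) (s : ℝ) : ear a s 0 = (s, 0, 0) := by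
  cases a <;> simp [ear]

namespace TemplateLink

open LabelledWords

variable {W : LabelledWords} (L : TemplateLink W)

theorem start_injective : Function.Injective L.start := by
  intro τ τ' h
  refine (L.injective τ τ' 0 (by simp) 0 (by simp) ?_).1
  rw [ear_zero, ear_zero]
  exact congrArg (fun s => ((s, 0, 0) : Space)) h

theorem abs_start_le (τ : W.Turn) : |L.start τ| ≤ 1 := by
  have h := L.pos_mem τ 0 (by simp)
  obtain ⟨⟨a, b⟩, j⟩ := τ
  rw [abs_le]
  cases a <;> simp [strip, start] at h ⊢ <;> constructor <;> linarith [h.1, h.2]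

theorem start_x_lt_start_y {τ τ' : W.Turn} (hτ : τ.1.1 = .x) (hτ' : τ'.1.1 = .y) :
    L.start τ < L.start τ' := by
  have h := L.pos_mem τ 0 (by simp)
  have h' := L.pos_mem τ' 0 (by simp)
  rw [hτ] at h
  rw [hτ'] at h'
  simp [strip] at h h'
  refine lt_of_le_of_ne (h.2.trans h'.1) fun he => ?_
  have := L.start_injective he
  simp_all

/-- Two strands of the same ear cannot cross, so that their end points on the branch line are in
the same order as their start points. -/
theorem start_next_lt {τ τ' : W.Turn} (ha : τ.1.1 = τ'.1.1) (h : L.start τ < L.start τ') :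
    L.start (W.next τ) < L.start (W.next τ') := by
  have hc : ContinuousOn (fun t => L.pos τ' t - L.pos τ t) (Icc 0 1) :=
    (L.continuousOn_pos τ').sub (L.continuousOn_pos τ)
  have hle : L.pos τ 1 ≤ L.pos τ' 1 := by
    by_contra! hlt
    -- By the intermediate value theorem the strands would meet at some time.
    obtain ⟨t, ht, h0⟩ := intermediate_value_Icc' zero_le_one hc
      (show (0 : ℝ) ∈ Icc _ _ from ⟨by linarith, by have := h; simp only [start] at this; linarith⟩)
    have h0' : L.pos τ' t - L.pos τ t = 0 := h0
    have ht1 : t ≠ 1 := by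
      rintro rfl
      linarith
    have hI : t ∈ Ico (0 : ℝ) 1 := ⟨ht.1, lt_of_le_of_ne ht.2 ht1⟩
    have := (L.injective τ τ' t hI t hI (by rw [ha, sub_eq_zero.1 h0'])).1
    exact h.ne (by rw [this])
  rw [L.pos_next, L.pos_next] at hle
  refine lt_of_le_of_ne hle fun he => ?_
  have := next_injective_of_letter_eq ha (L.start_injective he)
  exact h.ne (by rw [this])

theorem remaining_le_of_start_lt_x {τ τ' : W.Turn} (hτ : τ.1.1 = .x) (hτ' : τ'.1.1 = .x)
    (h : L.start τ < L.start τ') : remaining τ' ≤ remaining τ := by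
  induction hn : remaining τ generalizing τ τ' with
  | zero => exact absurd hn (remaining_pos τ).ne'
  | succ n ih =>
    have hlt := L.start_next_lt (hτ.trans hτ'.symm) h
    by_contra! hgt
    have h' := next_of_one_lt_remaining (τ := τ') (by omega)
    rw [hτ'] at h'
    rcases Nat.eq_zero_or_pos n with rfl | hn0
    · have hy : (W.next τ).1.1 = .y := by
        have := next_of_remaining_eq_one hn
        rw [hτ] at this
        cases h : (W.next τ).1.1 <;> simp_all
      exact lt_asymm hlt (L.start_x_lt_start_y h'.1 hy)
    · have h₁ := next_of_one_lt_remaining (τ := τ) (by omega)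
      rw [hτ] at h₁
      have := ih h₁.1 h'.1 hlt (by omega)
      omega

theorem remaining_le_of_start_lt_y {τ τ' : W.Turn} (hτ : τ.1.1 = .y) (hτ' : τ'.1.1 = .y)
    (h : L.start τ < L.start τ') : remaining τ ≤ remaining τ' := by
  induction hn : remaining τ' generalizing τ τ' with
  | zero => exact absurd hn (remaining_pos τ').ne'
  | succ n ih =>
    have hlt := L.start_next_lt (hτ.trans hτ'.symm) h
    by_contra! hgt
    have h' := next_of_one_lt_remaining (τ := τ) (by omega)
    rw [hτ] at h'
    rcases Nat.eq_zero_or_pos n with rfl | hn0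
    · have hy : (W.next τ').1.1 = .x := by
        have := next_of_remaining_eq_one hn
        rw [hτ'] at this
        cases h : (W.next τ').1.1 <;> simp_all
      exact lt_asymm hlt (L.start_x_lt_start_y hy h'.1)
    · have h₁ := next_of_one_lt_remaining (τ := τ') (by omega)
      rw [hτ'] at h₁
      have := ih h'.1 h₁.1 hlt (by omega)
      omega

/-- The `u`-th turns from the end of two powers of the same letter start in the same order as the
last turns of these powers: follow the strands through the ear `u - 1` times. -/
theorem start_lt_of_last_lt {a : Letter} {b b' : W.Base}
    (hlast : ∀ (j : Fin (W.exponent a b)) (j' : Fin (W.exponent a b')),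
      j.val + 1 = W.exponent a b → j'.val + 1 = W.exponent a b' →
        L.start ⟨(a, b), j⟩ < L.start ⟨(a, b'), j'⟩) {u : ℕ} (hu : 1 ≤ u)
    (j : Fin (W.exponent a b)) (j' : Fin (W.exponent a b'))
    (hj : j.val + u = W.exponent a b) (hj' : j'.val + u = W.exponent a b') :
    L.start ⟨(a, b), j⟩ < L.start ⟨(a, b'), j'⟩ := by
  induction u, hu using Nat.le_induction generalizing j j' with
  | base => exact hlast j j' hj hj'
  | succ u hu ih =>
    by_contra! hle
    have hn : ∀ (b : W.Base) (j : Fin (W.exponent a b)) (h : j.val + (u + 1) = W.exponent a b),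
        W.next ⟨(a, b), j⟩ = ⟨(a, b), ⟨j.val + 1, by dsimp only; omega⟩⟩ := by
      intro b j h
      unfold next
      rw [dif_pos (show j.val + 1 < W.exponent a b by omega)]
    have hlt := ih ⟨j.val + 1, by omega⟩ ⟨j'.val + 1, by omega⟩
      (by dsimp only; omega) (by dsimp only; omega)
    rcases hle.lt_or_eq with h | h
    · have := L.start_next_lt (τ := ⟨(a, b'), j'⟩) (τ' := ⟨(a, b), j⟩) rfl h
      rw [hn b j hj, hn b' j' hj'] at this
      exact lt_asymm hlt this
    · have := congrArg W.next (L.start_injective h)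
      rw [hn b j hj, hn b' j' hj'] at this
      rw [this] at hlt
      exact lt_irrefl _ hlt

/-! ### Bunches -/

theorem exists_sorted_list {α : Type*} [Fintype α] {key : α → ℝ} (h : Function.Injective key) :
    ∃ F : List α, F.Nodup ∧ (∀ b, b ∈ F) ∧ F.Pairwise fun b b' => key b < key b' :=
  let _ : LinearOrder α := LinearOrder.lift' key h
  ⟨(Finset.univ : Finset α).sort, Finset.sort_nodup _ _,
    fun b => (Finset.mem_sort _).2 (Finset.mem_univ b), (Finset.sortedLT_sort _).pairwise⟩

theorem eq_of_mem_interval {R s : ℝ} {i i' : ℤ} (h : s ∈ interval R i) (h' : s ∈ interval R i') :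
    i = i' := by
  obtain ⟨h₁, h₂⟩ := h
  obtain ⟨h₁', h₂'⟩ := h'
  have h₃ : (i : ℝ) < i' + 1 := by linarith
  have h₄ : (i' : ℝ) < i + 1 := by linarith
  norm_cast at h₃ h₄
  omega

theorem sgn_mul_cancel {a : Letter} {m n : ℤ} (h : a.sgn * m = a.sgn * n) : m = n := by
  cases a <;> simpa [Letter.sgn] using h

/-- If every turn starts from the interval given by the number of remaining letters of its power,
then the link is the union of its bunches: the full bunch is the family of last turns, sorted by
start points, and the bunch with index `u` consists of those bases whose exponent is at
least `u`. Positivity of `R` is needed only if there are turns at all; a system of no words puts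
no condition on `R`. -/
theorem isUnionOfBunches_of_start_mem {R : ℝ}
    (hR : ∀ τ : W.Turn, L.start τ ∈ interval R (τ.1.1.sgn * remaining τ))
    (hR0 : ∀ _ : W.Turn, 0 < R) :
    L.IsUnionOfBunches R := by
  classical
  let key : (a : Letter) → W.Base → ℝ := fun a b =>
    L.start ⟨(a, b), ⟨W.exponent a b - 1, Nat.sub_lt (W.exponent_pos a b) one_pos⟩⟩
  have key_eq : ∀ (a : Letter) (b : W.Base) (j : Fin (W.exponent a b)),
      j.val + 1 = W.exponent a b → L.start ⟨(a, b), j⟩ = key a b := by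
    intro a b j hj
    have : j = ⟨W.exponent a b - 1, Nat.sub_lt (W.exponent_pos a b) one_pos⟩ := by
      ext
      simp
      omega
    simp only [key, ← this]
  have key_inj : ∀ a, Function.Injective (key a) := by
    intro a b b' h
    have := congrArg (fun τ : W.Turn => τ.1.2) (L.start_injective h)
    exact this
  have hF : ∀ a, ∃ F : List W.Base, F.Nodup ∧ (∀ b, b ∈ F) ∧
      F.Pairwise fun b b' => key a b < key a b' :=
    fun a => exists_sorted_list (key_inj a)
  choose F hnd hmem hsort using hF
  have hfull : ∀ a, L.IsFullBunch a (F a) := by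
    intro a
    refine ⟨hnd a, hmem a, (hsort a).imp ?_, ?_⟩
    · intro b b' h j j' hj hj'
      rwa [key_eq a b j hj, key_eq a b' j' hj']
    · intro b b' j j' hj hj'
      have h := hR ⟨(a, b), j⟩
      have h' := hR ⟨(a, b'), j'⟩
      have hR1 := hR0 ⟨(a, b), j⟩
      rw [remaining_mk] at h h'
      have h₁ : W.exponent a b - j.val = 1 := by omega
      have h₂ : (2 : ℝ) ≤ ((W.exponent a b' - j'.val : ℕ) : ℝ) := by
        exact_mod_cast (show 2 ≤ W.exponent a b' - j'.val by omega)
      rw [h₁] at h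
      refine lt_of_mul_lt_mul_left ?_ hR1.le
      cases a
      · simp only [interval, Letter.sgn, mem_ofPred_eq, mem_Ioo, Int.cast_mul, Int.cast_neg,
          Int.cast_one, Int.cast_natCast, Nat.cast_one] at h h' ⊢
        linarith [h.1, h'.2]
      · simp only [interval, Letter.sgn, mem_ofPred_eq, mem_Ioo, Int.cast_mul,
          Int.cast_one, Int.cast_natCast, Nat.cast_one] at h h' ⊢
        linarith [h.2, h'.1]
  refine ⟨F, fun a u => (F a).filter fun b => u ≤ W.exponent a b, hfull, ?_, ?_⟩
  · intro a u hu
    refine ⟨List.filter_sublist, ?_, ?_⟩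
    · intro b j
      have h := hR ⟨(a, b), j⟩
      rw [remaining_mk] at h
      have hj := j.isLt
      simp only [List.mem_filter, hmem, true_and, decide_eq_true_eq]
      constructor
      · intro h'
        have := sgn_mul_cancel (eq_of_mem_interval h' h)
        omega
      · rintro ⟨-, h'⟩
        rwa [show W.exponent a b - j.val = u by omega] at h
    · refine ((hfull a).leftToRight.sublist List.filter_sublist).imp ?_
      intro b b' h
      exact L.start_lt_of_last_lt h hu.1
  · refine Subset.antisymm ?_ ?_
    · refine iUnion_subset fun τ => ?_
      obtain ⟨⟨a, b⟩, j⟩ := τ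
      have hj := j.isLt
      dsimp only at hj
      have hle : W.exponent a b ≤ W.maxExponent a :=
        Finset.le_sup (f := W.exponent a) (Finset.mem_univ b)
      intro P hP
      simp only [bunchOfTurns, mem_iUnion]
      exact ⟨a, W.exponent a b - j.val, ⟨by omega, by omega⟩, b,
        by simp [hmem], j, by omega, hP⟩
    · simp only [bunchOfTurns, iUnion_subset_iff]
      intro a u _ b _ j _
      exact subset_iUnion L.turn _

/-! ### The new start points -/

/-- The start point to which the start point of the turn `τ` is to be moved: in the coordinate
`R s` it is at distance at most `3/10` from the integer prescribed by the number of remaining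
letters. The term `3 / 10 * L.start τ` keeps the order inside each interval. -/
noncomputable def newStart (R : ℝ) (τ : W.Turn) : ℝ :=
  ((τ.1.1.sgn * remaining τ : ℤ) + 3 / 10 * L.start τ) / R

theorem pos_of_exponent_le {R : ℝ} (hR : ∀ a b, (W.exponent a b : ℝ) + 2 / 5 ≤ R) (τ : W.Turn) :
    0 < R := by
  have := hR τ.1.1 τ.1.2
  have : (0 : ℝ) ≤ W.exponent τ.1.1 τ.1.2 := by positivity
  linarith

theorem newStart_mem_interval {R : ℝ} (hR : ∀ a b, (W.exponent a b : ℝ) + 2 / 5 ≤ R)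
    (τ : W.Turn) : L.newStart R τ ∈ interval R (τ.1.1.sgn * remaining τ) := by
  have h0 := pos_of_exponent_le hR τ
  have h := abs_le.1 (L.abs_start_le τ)
  simp only [interval, newStart, mem_ofPred_eq, mem_Ioo, mul_div_cancel₀ _ h0.ne']
  constructor <;> linarith [h.1, h.2]

theorem newStart_lt_newStart {R : ℝ} (hR : ∀ a b, (W.exponent a b : ℝ) + 2 / 5 ≤ R)
    {τ τ' : W.Turn} (h : L.start τ < L.start τ') : L.newStart R τ < L.newStart R τ' := by
  have h0 := pos_of_exponent_le hR τ
  refine (div_lt_div_iff_of_pos_right h0).2 ?_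
  have hp : (1 : ℝ) ≤ remaining τ := by exact_mod_cast remaining_pos τ
  have hp' : (1 : ℝ) ≤ remaining τ' := by exact_mod_cast remaining_pos τ'
  rcases ha : τ.1.1 with _ | _ <;> rcases ha' : τ'.1.1 with _ | _
  · have : (remaining τ' : ℝ) ≤ remaining τ := by
      exact_mod_cast L.remaining_le_of_start_lt_x ha ha' h
    simp only [Letter.sgn]
    push_cast
    linarith
  · simp only [Letter.sgn]
    push_cast
    linarith
  · exact absurd h (L.start_x_lt_start_y ha' ha).not_gt
  · have : (remaining τ : ℝ) ≤ remaining τ' := by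
      exact_mod_cast L.remaining_le_of_start_lt_y ha ha' h
    simp only [Letter.sgn]
    push_cast
    linarith

theorem newStart_mem_Ioo {R : ℝ} (hR : ∀ a b, (W.exponent a b : ℝ) + 2 / 5 ≤ R) (τ : W.Turn) :
    L.newStart R τ ∈ Ioo (-1) 1 := by
  have h0 := pos_of_exponent_le hR τ
  have h := abs_le.1 (L.abs_start_le τ)
  have hp : (1 : ℝ) ≤ remaining τ := by exact_mod_cast remaining_pos τ
  have hle : (remaining τ : ℝ) ≤ W.exponent τ.1.1 τ.1.2 := by exact_mod_cast remaining_le τ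
  have hR' := hR τ.1.1 τ.1.2
  rw [newStart, mem_Ioo, lt_div_iff₀ h0, div_lt_iff₀ h0]
  rcases ha : τ.1.1 with _ | _ <;> rw [ha] at hR' hle <;> simp only [Letter.sgn] <;> push_cast <;>
    constructor <;> linarith [h.1, h.2]

theorem sgn_mul_newStart_pos {R : ℝ} (hR : ∀ a b, (W.exponent a b : ℝ) + 2 / 5 ≤ R)
    (τ : W.Turn) : 0 < τ.1.1.sgn * L.newStart R τ := by
  have h0 := pos_of_exponent_le hR τ
  have h := abs_le.1 (L.abs_start_le τ)
  have hp : (1 : ℝ) ≤ remaining τ := by exact_mod_cast remaining_pos τ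
  rw [newStart, ← mul_div_assoc]
  refine div_pos ?_ h0
  rcases ha : τ.1.1 with _ | _ <;> simp only [Letter.sgn] <;> push_cast <;> linarith [h.1, h.2]

end TemplateLink

/-! ### Increasing homeomorphisms of the line and of its products -/

/-- A strictly increasing function on a finite set of reals extends to a strictly increasing
continuous function on the line which is a translation on either side of the set: interpolate
linearly between the points of the set. -/
theorem exists_strictMono_continuous_extension (S : Finset ℝ) (f : ℝ → ℝ)
    (hf : StrictMonoOn f S) :
    ∃ g : ℝ → ℝ, Continuous g ∧ StrictMono g ∧ EqOn g f S ∧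
      (∀ m ∈ S, (∀ s ∈ S, s ≤ m) → ∀ s, m ≤ s → g s = s - m + f m) ∧
      (∀ m ∈ S, (∀ s ∈ S, m ≤ s) → ∀ s, s ≤ m → g s = s - m + f m) := by
  induction S using Finset.induction_on_max with
  | empty => exact ⟨id, continuous_id, strictMono_id, by simp, by simp, by simp⟩
  | insert m S hm ih =>
    rcases S.eq_empty_or_nonempty with rfl | hS
    · refine ⟨fun s => s - m + f m, by fun_prop, fun s s' h => by simpa using h, ?_, ?_, ?_⟩ <;>
        simp
    obtain ⟨g, hgc, hg, hgf, hright, hleft⟩ := ih (hf.mono (by simp))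
    set M := S.max' hS with hM
    have hMS : M ∈ S := S.max'_mem hS
    have hle : ∀ s ∈ S, s ≤ M := fun s hs => S.le_max' s hs
    have hMm : M < m := hm M hMS
    have hfm : f M < f m := hf (by simp [hMS]) (by simp) hMm
    have hgM := hright M hMS hle
    set k := (f m - f M) / (m - M) with hk
    have hk0 : 0 < k := div_pos (by linarith) (by linarith)
    have hkm : k * (m - M) = f m - f M := div_mul_cancel₀ _ (by linarith)
    -- The slope `1` of `g` on `[M, m]` is changed to `k`.
    let g' : ℝ → ℝ := fun s => g s + (k - 1) * (max M (min s m) - M)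
    have hlow : ∀ s, s ≤ M → g' s = g s := by
      intro s hs
      simp only [g']
      rw [max_eq_left ((min_le_left _ _).trans hs)]
      ring
    have hmid : ∀ s, M ≤ s → s ≤ m → g' s = f M + k * (s - M) := by
      intro s h₁ h₂
      simp only [g']
      rw [min_eq_left h₂, max_eq_right h₁, hgM s h₁]
      ring
    have hhigh : ∀ s, m ≤ s → g' s = s - m + f m := by
      intro s hs
      simp only [g']
      rw [min_eq_right hs, max_eq_right hMm.le, hgM s (hMm.le.trans hs)]
      linarith
    have h₁ : StrictMonoOn g' (Iic M) := by
      intro s hs s' hs' h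
      rw [hlow s hs, hlow s' hs']
      exact hg h
    have h₂ : StrictMonoOn g' (Icc M m) := by
      intro s hs s' hs' h
      rw [hmid s hs.1 hs.2, hmid s' hs'.1 hs'.2]
      nlinarith
    have h₃ : StrictMonoOn g' (Ici m) := by
      intro s hs s' hs' h
      rw [hhigh s hs, hhigh s' hs']
      linarith
    have h₁₂ : StrictMonoOn g' (Iic m) := by
      rw [← Iic_union_Icc_eq_Iic hMm.le]
      exact h₁.union h₂ isGreatest_Iic (isLeast_Icc hMm.le)
    have hmS : ∀ s ∈ S, s ≤ m := fun s hs => (hm s hs).le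
    refine ⟨g', by fun_prop, h₁₂.Iic_union_Ici h₃, ?_, ?_, ?_⟩
    · intro s hs
      rcases Finset.mem_insert.1 hs with rfl | hs
      · rw [hhigh s le_rfl]
        ring
      · rw [hlow s (hle s hs), hgf hs]
    · intro m' hm' hmax s hs
      have hmm : m' = m := by
        refine le_antisymm ?_ (hmax m (by simp))
        rcases Finset.mem_insert.1 hm' with rfl | h
        exacts [le_rfl, hmS _ h]
      rw [hmm] at hs ⊢
      exact hhigh s hs
    · intro m' hm' hmin s hs
      have hm'S : m' ∈ S := by
        rcases Finset.mem_insert.1 hm' with rfl | h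
        · exact absurd (hmin M (by simp [hMS])) hMm.not_ge
        · exact h
      rw [hlow s (hs.trans (hle _ hm'S))]
      exact hleft m' hm'S (fun s hs => hmin s (by simp [hs])) s hs

/-- A continuous self-map of `ℝ × Y` over `Y` which maps each fibre onto itself in a strictly
increasing way is a homeomorphism. -/
noncomputable def fibrewiseHomeomorph {Y : Type*} [TopologicalSpace Y] (F : ℝ × Y → ℝ)
    (hF : Continuous F) (hm : ∀ y, StrictMono fun s => F (s, y))
    (hs : ∀ y, Function.Surjective fun s => F (s, y)) : ℝ × Y ≃ₜ ℝ × Y where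
  toEquiv := Equiv.ofBijective (fun P => (F P, P.2)) <| by
    constructor
    · rintro ⟨s, y⟩ ⟨s', y'⟩ h
      obtain ⟨h, rfl⟩ := Prod.mk.inj h
      rw [(hm y).injective h]
    · rintro ⟨s, y⟩
      obtain ⟨s', h⟩ := hs y s
      exact ⟨(s', y), Prod.ext h rfl⟩
  continuous_toFun := hF.prodMk continuous_snd
  continuous_invFun := by
    generalize_proofs hbij
    set e : ℝ × Y ≃ ℝ × Y := Equiv.ofBijective (fun P => (F P, P.2)) hbij
    have h₀ : ∀ P, (F (e.symm P), (e.symm P).2) = P := e.apply_symm_apply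
    have h₂ : ∀ P, (e.symm P).2 = P.2 := fun P => (Prod.ext_iff.1 (h₀ P)).2
    have h₁ : ∀ P, F ((e.symm P).1, P.2) = P.1 := fun P => by
      rw [← h₂ P]
      exact (Prod.ext_iff.1 (h₀ P)).1
    have hc : ∀ s : ℝ, Continuous fun P : ℝ × Y => F (s, P.2) := fun s => by fun_prop
    have hlt : ∀ s P, s < (e.symm P).1 ↔ F (s, P.2) < P.1 := fun s P => by
      rw [← (hm P.2).lt_iff_lt, h₁]
    have hgt : ∀ s P, (e.symm P).1 < s ↔ P.1 < F (s, P.2) := fun s P => by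
      rw [← (hm P.2).lt_iff_lt, h₁]
    have hfst : Continuous fun P => (e.symm P).1 := by
      refine continuous_iff_continuousAt.2 fun P => tendsto_order.2 ⟨fun s hs => ?_, fun s hs => ?_⟩
      · simp only [hlt] at hs ⊢
        exact (hc s).continuousAt.eventually_lt continuous_fst.continuousAt hs
      · simp only [hgt] at hs ⊢
        exact continuous_fst.continuousAt.eventually_lt (hc s).continuousAt hs
    exact (hfst.prodMk continuous_snd).congr fun P => Prod.ext rfl (h₂ P).symm

/-! ### The isotopy along the branch line -/

/-- A continuous cut-off function around the origin of the `(q, d)`-plane. -/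
noncomputable def cutoff (δ : ℝ) (z : ℝ × ℝ) : ℝ := max 0 (1 - ‖z‖ / δ)

theorem continuous_cutoff (δ : ℝ) : Continuous (cutoff δ) := by
  unfold cutoff
  fun_prop

theorem cutoff_nonneg (δ : ℝ) (z : ℝ × ℝ) : 0 ≤ cutoff δ z := le_max_left _ _

theorem cutoff_le_one {δ : ℝ} (hδ : 0 < δ) (z : ℝ × ℝ) : cutoff δ z ≤ 1 :=
  max_le zero_le_one (sub_le_self _ (by positivity))

theorem cutoff_zero (δ : ℝ) : cutoff δ 0 = 1 := by simp [cutoff]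

theorem cutoff_eq_zero {δ : ℝ} (hδ : 0 < δ) {z : ℝ × ℝ} (h : δ ≤ ‖z‖) : cutoff δ z = 0 :=
  max_eq_left (sub_nonpos.2 ((one_le_div hδ).2 h))

/-- The first coordinate of the point to which `(p, z)`, `z = (q, d)`, is moved: in the
coordinates `(s, q, d)`, where `s = p + 2 d`, the point moves from `s` towards `g s`, by the
proportion `c * cutoff δ z` of the whole way. -/
noncomputable def slide (g : ℝ → ℝ) (δ c : ℝ) (P : Space) : ℝ :=
  P.1 + c * cutoff δ P.2 * (g (P.1 + 2 * P.2.2) - (P.1 + 2 * P.2.2))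

theorem continuous_slide {g : ℝ → ℝ} (hg : Continuous g) (δ : ℝ) :
    Continuous fun x : ℝ × Space => slide g δ x.1 x.2 := by
  have := continuous_cutoff δ
  unfold slide
  fun_prop

theorem strictMono_slide {g : ℝ → ℝ} (hg : StrictMono g) {δ : ℝ} (hδ : 0 < δ) {c : ℝ}
    (hc : c ∈ Icc (0 : ℝ) 1) (z : ℝ × ℝ) : StrictMono fun p => slide g δ c (p, z) := by
  intro p p' h
  have h₀ : 0 ≤ c * cutoff δ z := mul_nonneg hc.1 (cutoff_nonneg _ _)
  have h₁ : c * cutoff δ z ≤ 1 :=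
    mul_le_one₀ hc.2 (cutoff_nonneg _ _) (cutoff_le_one hδ _)
  have hlt := hg (show p + 2 * z.2 < p' + 2 * z.2 by linarith)
  simp only [slide]
  rcases h₁.lt_or_eq with h₁ | h₁
  · nlinarith
  · rw [h₁]
    linarith

theorem surjective_slide {g : ℝ → ℝ} (hg : Continuous g) {C : ℝ} (hC : ∀ s, C ≤ |s| → g s = s)
    (δ c : ℝ) (z : ℝ × ℝ) : Function.Surjective fun p => slide g δ c (p, z) := by
  have hfix : ∀ p, C ≤ |p + 2 * z.2| → p = slide g δ c (p, z) := by
    intro p hp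
    simp [slide, hC _ hp]
  refine Continuous.surjective ((continuous_slide hg δ).comp (by fun_prop :
    Continuous fun p : ℝ => (c, ((p, z) : Space)))) ?_ ?_
  · refine Filter.tendsto_id.congr' ?_
    filter_upwards [Filter.eventually_ge_atTop (C - 2 * z.2)] with p hp
    exact hfix p ((by linarith : C ≤ p + 2 * z.2).trans (le_abs_self _))
  · refine Filter.tendsto_id.congr' ?_
    filter_upwards [Filter.eventually_le_atBot (-C - 2 * z.2)] with p hp
    exact hfix p ((by linarith : C ≤ -(p + 2 * z.2)).trans (neg_le_abs _))

/-- The projection of the line `s = const` of an ear to the `(q, d)`-plane. It is the same for all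
`s`: a circle through the origin. -/
noncomputable def earCircle (a : Letter) (t : ℝ) : ℝ × ℝ := (ear a 0 t).2

theorem earCircle_zero (a : Letter) : earCircle a 0 = 0 := by
  simp [earCircle, ear_zero]

theorem earCircle_one (a : Letter) : earCircle a 1 = 0 := by
  cases a <;> simp [earCircle, ear]

theorem continuous_earCircle (a : Letter) : Continuous (earCircle a) := by
  cases a <;> unfold earCircle ear <;> fun_prop

theorem earCircle_eq_zero {a : Letter} {t : ℝ} (ht : t ∈ Icc (0 : ℝ) 1) (h : earCircle a t = 0) :
    t = 0 ∨ t = 1 := by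
  have hcos : Real.cos (2 * Real.pi * t) = 1 := by
    have := congrArg Prod.snd h
    cases a <;> simp [earCircle, ear] at this <;> linarith
  obtain ⟨n, hn⟩ := (Real.cos_eq_one_iff _).1 hcos
  have hnt : (n : ℝ) = t := by
    have := Real.pi_pos
    refine mul_right_cancel₀ (b := 2 * Real.pi) (by positivity) ?_
    linarith
  have h₀ : 0 ≤ n := by exact_mod_cast hnt ▸ ht.1
  have h₁ : n ≤ 1 := by exact_mod_cast hnt ▸ ht.2
  have : n = 0 ∨ n = 1 := by omega
  rcases this with rfl | rfl
  · exact Or.inl (by simpa using hnt.symm)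
  · exact Or.inr (by simpa using hnt.symm)

theorem ear_eq (a : Letter) (s t : ℝ) :
    ear a s t = (s - 2 * (earCircle a t).2, earCircle a t) := by
  cases a <;> simp [ear, earCircle]
  ring

/-- The isotopy slides points along the lines of constant `(q, d)`, and so it keeps the time
parameter `t` of a point of an ear. -/
theorem slide_ear (g : ℝ → ℝ) (δ c : ℝ) (a : Letter) (s t : ℝ) :
    (slide g δ c (ear a s t), (ear a s t).2) =
      ear a (s + c * cutoff δ (earCircle a t) * (g s - s)) t := by
  simp only [ear_eq, slide]
  ext <;> simp
  ring

theorem convex_strip (a : Letter) (t : ℝ) : Convex ℝ (strip a t) := by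
  cases a <;> exact convex_Icc _ _

/-! ### Moving the start points of a link -/

/-- A property that holds near the zeros of a continuous nonnegative function on a compact set
holds wherever the function is small. -/
theorem IsCompact.exists_pos_forall_lt {X : Type*} [TopologicalSpace X] {K : Set X}
    (hK : IsCompact K) {f : X → ℝ} (hf : ContinuousOn f K) (hf0 : ∀ x ∈ K, 0 ≤ f x)
    {p : X → Prop} (hp : ∀ x ∈ K, f x = 0 → ∀ᶠ y in nhdsWithin x K, p y) :
    ∃ δ > 0, ∀ x ∈ K, f x < δ → p x := by
  let V : Set X := ⋃ (O : Set X) (_ : IsOpen O ∧ ∀ y ∈ O ∩ K, p y), O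
  have hV : IsOpen V := isOpen_biUnion fun O hO => hO.1
  have hVp : ∀ y ∈ V, y ∈ K → p y := by
    intro y hy hyK
    obtain ⟨O, hO, hyO⟩ := mem_iUnion₂.1 hy
    exact hO.2 y ⟨hyO, hyK⟩
  have hpos : ∀ x ∈ K \ V, 0 < f x := by
    intro x hx
    refine lt_of_le_of_ne (hf0 x hx.1) fun h0 => hx.2 ?_
    obtain ⟨O, hO, hxO, hOp⟩ := mem_nhdsWithin.1 (hp x hx.1 h0.symm)
    exact mem_iUnion₂.2 ⟨O, ⟨hO, fun y hy => hOp hy⟩, hxO⟩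
  obtain ⟨δ, hδ, h⟩ := (hK.diff hV).exists_forall_le' (hf.mono sdiff_subset) hpos
  refine ⟨δ, hδ, fun x hx hlt => ?_⟩
  by_contra hpx
  exact hlt.not_ge (h x ⟨hx, fun hxV => hpx (hVp x hxV hx)⟩)

namespace TemplateLink

variable {W : LabelledWords} (L : TemplateLink W)

/-- A strand whose end points are moved by `g` into the interior of the cross-sections is moved by
`g` inside the cross-sections near its end points. -/
theorem exists_pos_forall_mem_strip {g : ℝ → ℝ} (hg : Continuous g) (τ : W.Turn)
    (h0 : 0 < τ.1.1.sgn * g (L.start τ)) (h1 : g (L.start τ) ∈ Ioo (-1) 1)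
    (h2 : g (L.start (W.next τ)) ∈ Ioo (-1) 1) :
    ∃ δ > 0, ∀ t ∈ Icc (0 : ℝ) 1, ‖earCircle τ.1.1 t‖ < δ → g (L.pos τ t) ∈ strip τ.1.1 t := by
  have hc : ContinuousOn (fun t => g (L.pos τ t)) (Icc 0 1) :=
    hg.comp_continuousOn (L.continuousOn_pos τ)
  refine isCompact_Icc.exists_pos_forall_lt (continuous_earCircle _).norm.continuousOn
    (fun _ _ => norm_nonneg _) ?_
  intro t ht hz
  have hct := hc t ht
  rcases earCircle_eq_zero ht (norm_eq_zero.1 hz) with rfl | rfl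
  · have e₁ := hct.eventually (lt_mem_nhds h1.1)
    have e₂ := hct.eventually (gt_mem_nhds h1.2)
    have e₃ := (hct.const_mul (τ.1.1.sgn : ℝ)).eventually (lt_mem_nhds h0)
    filter_upwards [e₁, e₂, e₃] with t h₁ h₂ h₃
    rcases ha : τ.1.1 with _ | _ <;> rw [ha] at h₃ <;> simp [Letter.sgn] at h₃
    · exact ⟨h₁.le, h₃.le.trans (le_max_left _ _)⟩
    · exact ⟨(neg_nonpos.2 (le_max_left _ _)).trans h₃.le, h₂.le⟩
  · have hnext : L.pos τ 1 = L.start (W.next τ) := L.pos_next τ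
    rw [← hnext] at h2
    have e₁ := hct.eventually (lt_mem_nhds h2.1)
    have e₂ := hct.eventually (gt_mem_nhds h2.2)
    have ht' : ContinuousWithinAt (fun t : ℝ => 2 * t - 1) (Icc 0 1) 1 := by fun_prop
    have e₃ := Filter.Tendsto.eventually_lt hct ht' (by linarith [h2.2])
    have e₄ := Filter.Tendsto.eventually_lt ht'.neg hct (by simp only [Pi.neg_apply]; linarith [h2.1])
    filter_upwards [e₁, e₂, e₃, e₄] with t h₁ h₂ h₃ h₄
    rcases ha : τ.1.1 with _ | _
    · exact ⟨h₁.le, h₃.le.trans (le_max_right _ _)⟩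
    · exact ⟨(neg_le_neg (le_max_right _ _)).trans h₄.le, h₂.le⟩

/-- Start points can be moved freely along the branch line, in the given order, by an ambient
isotopy supported near the branch line. -/
theorem exists_ambientIsotopic_start_eq (U : Set Space) (hU : IsOpen U) (hTU : lorenzTemplate ⊆ U)
    (f : W.Turn → ℝ) (hf : ∀ τ τ', L.start τ < L.start τ' → f τ < f τ')
    (hf1 : ∀ τ, f τ ∈ Ioo (-1) 1) (hf0 : ∀ τ, 0 < τ.1.1.sgn * f τ) :
    ∃ L' : TemplateLink W, AmbientIsotopic U L L' ∧ ∀ τ, L'.start τ = f τ := by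
  classical
  -- A neighbourhood of the branch line in `U`, in the coordinates `(s, q, d)`.
  obtain ⟨ε, hε, hεU⟩ : ∃ ε > 0, ∀ s : ℝ, ∀ z : ℝ × ℝ, |s| < 1 + ε → ‖z‖ < ε →
      ((s - 2 * z.2, z) : Space) ∈ U := by
    have hK : IsCompact (Icc (-1 : ℝ) 1 ×ˢ {(0 : ℝ × ℝ)}) := isCompact_Icc.prod isCompact_singleton
    have hO : IsOpen ((fun x : ℝ × ℝ × ℝ => ((x.1 - 2 * x.2.2, x.2) : Space)) ⁻¹' U) :=
      hU.preimage (by fun_prop)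
    obtain ⟨ε, hε, h⟩ := hK.exists_thickening_subset_open hO (by
      rintro ⟨s, z⟩ ⟨hs, rfl⟩
      refine hTU ?_
      rcases le_total s 0 with h | h
      · exact ⟨.x, 0, by simp, s, ⟨hs.1, h.trans (le_max_left _ _)⟩, by simp [ear]; rfl⟩
      · exact ⟨.y, 0, by simp, s, ⟨(neg_nonpos.2 (le_max_left _ _)).trans h, hs.2⟩,
          by simp [ear]; rfl⟩)
    refine ⟨ε, hε, fun s z hs hz => mem_preimage.1
      (h (Metric.mem_thickening_iff.2 ?_ : (s, z) ∈ Metric.thickening ε _))⟩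
    rw [abs_lt] at hs
    refine ⟨(max (-1) (min s 1), 0), ⟨⟨le_max_left _ _, by simp⟩, rfl⟩, ?_⟩
    rw [Prod.dist_eq, max_lt_iff]
    refine ⟨?_, by simpa using hz⟩
    rw [Real.dist_eq, abs_lt]
    rcases max_cases (-1) (min s 1) with h | h <;> rcases min_cases s 1 with h' | h' <;>
      constructor <;> linarith [h.1, h.2, h'.1, h'.2]
  -- The homeomorphism `g` of the line which carries the start points to their new positions.
  obtain ⟨g, hgc, hg, hgf, hgC⟩ : ∃ g : ℝ → ℝ, Continuous g ∧ StrictMono g ∧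
      (∀ τ, g (L.start τ) = f τ) ∧ ∀ s, 1 + ε / 2 ≤ |s| → g s = s := by
    let F : ℝ → ℝ := Function.extend L.start f id
    have hF : ∀ τ, F (L.start τ) = f τ := fun τ => L.start_injective.extend_apply f id τ
    have hout : ∀ s, 1 < |s| → F s = s := by
      intro s hs
      refine Function.extend_apply' f id s ?_
      rintro ⟨τ, rfl⟩
      exact hs.not_ge (L.abs_start_le τ)
    have hFb : F (1 + ε / 2) = 1 + ε / 2 :=
      hout _ (lt_of_lt_of_le (by linarith) (le_abs_self _))
    have hFa : F (-(1 + ε / 2)) = -(1 + ε / 2) :=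
      hout _ (lt_of_lt_of_le (by linarith) (neg_le_abs _))
    let S : Finset ℝ := insert (-(1 + ε / 2)) (insert (1 + ε / 2) (Finset.univ.image L.start))
    have hS : ∀ s ∈ S, s = -(1 + ε / 2) ∨ s = 1 + ε / 2 ∨ ∃ τ, L.start τ = s := by
      intro s hs
      rcases Finset.mem_insert.1 hs with h | hs
      · exact .inl h
      rcases Finset.mem_insert.1 hs with h | hs
      · exact .inr (.inl h)
      · obtain ⟨τ, -, h⟩ := Finset.mem_image.1 hs
        exact .inr (.inr ⟨τ, h⟩)
    have hSa : -(1 + ε / 2) ∈ S := Finset.mem_insert_self _ _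
    have hSb : 1 + ε / 2 ∈ S := Finset.mem_insert_of_mem (Finset.mem_insert_self _ _)
    have hSτ : ∀ τ, L.start τ ∈ S := fun τ => Finset.mem_insert_of_mem
      (Finset.mem_insert_of_mem (Finset.mem_image_of_mem _ (Finset.mem_univ τ)))
    have hmono : StrictMonoOn F S := by
      intro s hs s' hs' h
      rcases hS s hs with rfl | rfl | ⟨τ, rfl⟩ <;> rcases hS s' hs' with rfl | rfl | ⟨τ', rfl⟩
      · exact absurd h (lt_irrefl _)
      · rwa [hFa, hFb]
      · rw [hFa, hF]
        linarith [(hf1 τ').1]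
      · linarith
      · exact absurd h (lt_irrefl _)
      · linarith [(abs_le.1 (L.abs_start_le τ')).2]
      · linarith [(abs_le.1 (L.abs_start_le τ)).1]
      · rw [hFb, hF]
        linarith [(hf1 τ).2]
      · rw [hF, hF]
        exact hf τ τ' h
    obtain ⟨g, hgc, hg, hgF, hr, hl⟩ := exists_strictMono_continuous_extension S F hmono
    refine ⟨g, hgc, hg, fun τ => (hgF (hSτ τ)).trans (hF τ), fun s hs => ?_⟩
    rcases le_abs'.1 hs with h | h
    · rw [hl _ hSa ?_ s h, hFa]
      · ring
      · intro s hs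
        rcases hS s hs with rfl | rfl | ⟨τ, rfl⟩
        · exact le_rfl
        · linarith
        · linarith [(abs_le.1 (L.abs_start_le τ)).1]
    · rw [hr _ hSb ?_ s h, hFb]
      · ring
      · intro s hs
        rcases hS s hs with rfl | rfl | ⟨τ, rfl⟩
        · linarith
        · exact le_rfl
        · linarith [(abs_le.1 (L.abs_start_le τ)).2]
  -- The size `δ` of the support of the cut-off function.
  obtain ⟨δ, hδ, hδε, hstrip⟩ : ∃ δ > 0, δ ≤ ε ∧ ∀ τ : W.Turn, ∀ t ∈ Icc (0 : ℝ) 1,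
      ‖earCircle τ.1.1 t‖ < δ → g (L.pos τ t) ∈ strip τ.1.1 t := by
    have h : ∀ τ : W.Turn, ∃ δ > 0, ∀ t ∈ Icc (0 : ℝ) 1,
        ‖earCircle τ.1.1 t‖ < δ → g (L.pos τ t) ∈ strip τ.1.1 t := fun τ =>
      L.exists_pos_forall_mem_strip hgc τ (by rw [hgf]; exact hf0 τ) (by rw [hgf]; exact hf1 τ)
        (by rw [hgf]; exact hf1 _)
    choose δ hδ h using h
    have hfin : ∀ᶠ x in nhdsWithin (0 : ℝ) (Ioi 0), ∀ τ, x < δ τ :=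
      Filter.eventually_all.2 fun τ => nhdsWithin_le_nhds (gt_mem_nhds (hδ τ))
    obtain ⟨x, ⟨hx, hxε⟩, hx0⟩ := ((hfin.and
      (nhdsWithin_le_nhds (ge_mem_nhds hε))).and self_mem_nhdsWithin).exists
    exact ⟨x, hx0, hxε, fun τ t ht hlt => h τ t ht (hlt.trans (hx τ))⟩
  let H : unitInterval → (Space ≃ₜ Space) := fun u =>
    fibrewiseHomeomorph (slide g δ u)
      ((continuous_slide hgc δ).comp (by fun_prop : Continuous fun P : Space => ((u : ℝ), P)))
      (strictMono_slide hg hδ u.2) (surjective_slide hgc hgC δ u)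
  have hH : ∀ u P, H u P = (slide g δ u P, P.2) := fun _ _ => rfl
  have hHear : ∀ a s t, H 1 (ear a s t) = ear a (s + cutoff δ (earCircle a t) * (g s - s)) t := by
    intro a s t
    rw [hH, slide_ear]
    simp
  let pos' : W.Turn → ℝ → ℝ := fun τ t =>
    L.pos τ t + cutoff δ (earCircle τ.1.1 t) * (g (L.pos τ t) - L.pos τ t)
  have hpos0 : ∀ τ, pos' τ 0 = g (L.start τ) := by
    intro τ
    simp [pos', earCircle_zero, cutoff_zero, start]
  let L' : TemplateLink W :=
    { pos := pos'
      continuousOn_pos := by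
        intro τ
        have h := L.continuousOn_pos τ
        exact h.add ((((continuous_cutoff δ).comp (continuous_earCircle _)).continuousOn).mul
          ((hgc.comp_continuousOn h).sub h))
      pos_mem := by
        intro τ t ht
        rcases lt_or_ge ‖earCircle τ.1.1 t‖ δ with h | h
        · have := (convex_strip τ.1.1 t).add_smul_sub_mem (L.pos_mem τ t ht) (hstrip τ t ht h)
            ⟨cutoff_nonneg δ (earCircle τ.1.1 t), cutoff_le_one hδ _⟩
          exact this
        · simpa [pos', cutoff_eq_zero hδ h] using L.pos_mem τ t ht
      pos_next := by
        intro τ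
        rw [hpos0]
        simp only [pos', earCircle_one, cutoff_zero, L.pos_next τ, start]
        ring
      injective := by
        intro τ τ' t ht t' ht' h
        rw [← hHear, ← hHear] at h
        exact L.injective τ τ' t ht t' ht' ((H 1).injective h) }
  refine ⟨L', ⟨H, ?_, ?_, ?_, ?_⟩, fun τ => (hpos0 τ).trans (hgf τ)⟩
  · exact ((continuous_slide hgc δ).comp (by fun_prop :
      Continuous fun z : unitInterval × Space => ((z.1 : ℝ), z.2))).prodMk (by fun_prop)
  · intro P
    simp [hH, slide]
  · rintro u ⟨p, z⟩ hP
    rw [hH]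
    rcases lt_or_ge ‖z‖ ε with h | h
    · have hs : 1 + ε ≤ |p + 2 * z.2| := by
        by_contra! hlt
        have := hεU _ z hlt h
        rw [add_sub_cancel_right] at this
        exact hP this
      simp [slide, hgC _ ((by linarith : 1 + ε / 2 ≤ 1 + ε).trans hs)]
    · simp [slide, cutoff_eq_zero hδ (hδε.trans h)]
  · intro τ
    simp only [turn, image_image, hHear]
    rfl

end TemplateLink

/-! ### Links in the position of bunches -/

theorem mainTheorem5 (W : LabelledWords) (hW : W.IsModular) (L : TemplateLink W)
    (U : Set Space) (hU : IsOpen U) (hTU : lorenzTemplate ⊆ U)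
    (R : ℝ) (hR : ∀ a b, (W.exponent a b : ℝ) + 2 / 5 ≤ R) :
    ∃ L' : TemplateLink W,
      TemplateLink.AmbientIsotopic U L L' ∧
      L'.IsUnionOfBunches R ∧
      (∀ (b : W.Base),
        L'.start ⟨(Letter.x, b), ⟨0, W.exponent_pos _ _⟩⟩ ∈
          TemplateLink.interval R (-(W.exponent Letter.x b : ℤ))) ∧
      (∀ (b : W.Base),
        L'.start ⟨(Letter.y, b), ⟨0, W.exponent_pos _ _⟩⟩ ∈
          TemplateLink.interval R (W.exponent Letter.y b : ℤ)) := by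
  obtain ⟨L', hiso, hstart⟩ := L.exists_ambientIsotopic_start_eq U hU hTU (L.newStart R)
    (fun _ _ => L.newStart_lt_newStart hR) (L.newStart_mem_Ioo hR) (L.sgn_mul_newStart_pos hR)
  have hint : ∀ τ : W.Turn, L'.start τ ∈
      TemplateLink.interval R (τ.1.1.sgn * LabelledWords.remaining τ) := by
    intro τ
    rw [hstart]
    exact L.newStart_mem_interval hR τ
  refine ⟨L', hiso, L'.isUnionOfBunches_of_start_mem hint
    (TemplateLink.pos_of_exponent_le hR), fun b => ?_, fun b => ?_⟩
  · simpa [Letter.sgn, LabelledWords.remaining] using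
      hint ⟨(Letter.x, b), ⟨0, W.exponent_pos _ _⟩⟩
  · simpa [Letter.sgn, LabelledWords.remaining] using
      hint ⟨(Letter.y, b), ⟨0, W.exponent_pos _ _⟩⟩
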